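/- Let $H$ be a complex Hilbert space of finite dimension $d \ge 1$, let $\Pi^1,\dots,\Pi^N$ ($N\ge 1$) be observables, that is, Hermitian operators on $H$, and for each $i$ let $(|\psi^i_j\rangle)_{j=1}^d$ be an orthonormal basis of eigenvectors of $\Pi^i$; write $\Pi^i_j = |\psi^i_j\rangle\langle\psi^i_j|$. (The case of interest is that of noncommuting observables, but the statement holds whether or not they commute.) For a measurement $M=(M_a)_a$ (a POVM with finitely many outcomes: positive operators with $\sum_a M_a = I$) and a choice $a\mapsto\sigma_a$ of density operators on $H$, let $$F(M,\sigma)=\frac1{Nd}\sum_{i=1}^N\sum_{j=1}^d\sum_a \operatorname{Tr}(\Pi^i_jM_a)\operatorname{Tr}(\Pi^i_j\sigma_a),$$ and define the incompatibility $Q(\Pi)=1-\sup_{M,\sigma}F(M,\sigma)$. Then, for every $N \ge 1$, $$Q(\Pi)\le\Bigl(1-\frac1N\Bigr)\Bigl(1-\frac1d\Bigr)\quad\text{and}\quad Q(\Pi)\le\frac{d-1}{d+1}.$$ The first bound is at most the second if $N\le d+1$, and the second is at most the first if $N\ge d+1$. -/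

import Mathlib

namespace Incompatibility

noncomputable section

/-- The rank-one operator `|v⟩⟨v|` on `H`, a pure state when `v` is a unit vector. -/
def pureState {H : Type*} [NormedAddCommGroup H] [InnerProductSpace ℂ H] (v : H) :
    H →ₗ[ℂ] H :=
  (InnerProductSpace.rankOne ℂ v v).toLinearMap

/-- A positive operator valued measure on `H` with `n` outcomes: positive operators that sum to
the identity. -/
structure POVM (H : Type*) [NormedAddCommGroup H] [InnerProductSpace ℂ H] (n : ℕ) where
  effect : Fin n → (H →ₗ[ℂ] H)
  isPositive : ∀ a, (effect a).IsPositive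
  sum_eq_id : ∑ a, effect a = LinearMap.id

/-- A (possibly mixed) quantum state on `H`: a positive operator of trace one. -/
structure DensityOperator (H : Type*) [NormedAddCommGroup H] [InnerProductSpace ℂ H] where
  op : H →ₗ[ℂ] H
  isPositive : op.IsPositive
  trace_eq_one : LinearMap.trace ℂ H op = 1

/-- `ψ` is a complete orthonormal system of eigenvectors of the operator `A`. -/
def IsEigenbasis {H : Type*} [NormedAddCommGroup H] [InnerProductSpace ℂ H] {d : ℕ}
    (A : H →ₗ[ℂ] H) (ψ : OrthonormalBasis (Fin d) ℂ H) : Prop :=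
  ∀ j, ∃ μ : ℂ, Module.End.HasEigenvector A μ (ψ j)

section Fidelity

variable {H : Type*} [NormedAddCommGroup H] [InnerProductSpace ℂ H] {N d : ℕ}

/-- The average fidelity `(1 / (N d)) ∑_{i,j,a} Tr(Π_{ij} M_a) Tr(Π_{ij} σ_a)` of the ensemble of
the equiprobable pure states `Π_{ij} = |ψ_{ij}⟩⟨ψ_{ij}|`, for the measurement `M` and the state
reconstruction map `a ↦ σ_a`. All these traces are real; the real part only changes the type. -/
def averageFidelity (ψ : Fin N → OrthonormalBasis (Fin d) ℂ H) {n : ℕ} (M : POVM H n)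
    (σ : Fin n → DensityOperator H) : ℝ :=
  1 / ((N : ℝ) * (d : ℝ)) * ∑ i, ∑ j, ∑ a,
    (LinearMap.trace ℂ H (pureState (ψ i j) * M.effect a)).re *
      (LinearMap.trace ℂ H (pureState (ψ i j) * (σ a).op)).re

/-- The values of the average fidelity over all measurements and all state reconstruction maps. -/
def fidelityValues (ψ : Fin N → OrthonormalBasis (Fin d) ℂ H) : Set ℝ :=
  {F | ∃ (n : ℕ) (M : POVM H n) (σ : Fin n → DensityOperator H), F = averageFidelity ψ M σ}

/-- The optimal (accessible) fidelity: the supremum of the average fidelity over all measurements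
and all state reconstruction maps. -/
def optimalFidelity (ψ : Fin N → OrthonormalBasis (Fin d) ℂ H) : ℝ :=
  sSup (fidelityValues ψ)

/-- The measure of incompatibility `Q = 1 - F` of observables with eigenbases `ψ i`. -/
def incompatibility (ψ : Fin N → OrthonormalBasis (Fin d) ℂ H) : ℝ :=
  1 - optimalFidelity ψ

theorem trace_pureState_mul [FiniteDimensional ℂ H] (v : H) (T : H →ₗ[ℂ] H) :
    LinearMap.trace ℂ H (pureState v * T) = inner ℂ v (T v) := by
  rw [LinearMap.trace_mul_comm]
  have h : T * pureState v =
      (InnerProductSpace.rankOne ℂ (T v) v).toLinearMap := by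
    ext x
    simp [pureState]
  rw [h, InnerProductSpace.trace_rankOne]

theorem DensityOperator.re_inner_le_one (σ : DensityOperator H)
    (b : OrthonormalBasis (Fin d) ℂ H) (j : Fin d) :
    (inner ℂ (b j) (σ.op (b j))).re ≤ 1 := by
  have h : ∑ k, (inner ℂ (b k) (σ.op (b k))).re = 1 := by
    rw [← Complex.re_sum, ← LinearMap.trace_eq_sum_inner _ b, σ.trace_eq_one, Complex.one_re]
  rw [← h]
  exact Finset.single_le_sum (f := fun k => (inner ℂ (b k) (σ.op (b k))).re)
    (fun k _ => σ.isPositive.re_inner_nonneg_right (b k)) (Finset.mem_univ j)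

/-- Average fidelities are at most `1`, so the supremum is a genuine one. -/
theorem averageFidelity_le_one [FiniteDimensional ℂ H]
    (ψ : Fin N → OrthonormalBasis (Fin d) ℂ H) {n : ℕ} (M : POVM H n)
    (σ : Fin n → DensityOperator H) : averageFidelity ψ M σ ≤ 1 := by
  have key : ∀ i j, ∑ a, (LinearMap.trace ℂ H (pureState (ψ i j) * M.effect a)).re *
      (LinearMap.trace ℂ H (pureState (ψ i j) * (σ a).op)).re ≤ 1 := by
    intro i j
    have hM : ∑ a, (inner ℂ (ψ i j) (M.effect a (ψ i j))).re = 1 := by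
      rw [← Complex.re_sum, ← inner_sum, ← LinearMap.sum_apply, M.sum_eq_id]
      simp
    simp only [trace_pureState_mul]
    rw [← hM]
    refine Finset.sum_le_sum fun a _ => ?_
    exact mul_le_of_le_one_right ((M.isPositive a).re_inner_nonneg_right _)
      ((σ a).re_inner_le_one (ψ i) j)
  have hsum : ∑ i, ∑ j, ∑ a, (LinearMap.trace ℂ H (pureState (ψ i j) * M.effect a)).re *
      (LinearMap.trace ℂ H (pureState (ψ i j) * (σ a).op)).re ≤ (N : ℝ) * d := by
    refine (Finset.sum_le_sum fun i _ => Finset.sum_le_sum fun j _ => key i j).trans ?_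
    simp
  unfold averageFidelity
  rw [one_div]
  refine (mul_le_mul_of_nonneg_left hsum (by positivity)).trans ?_
  exact inv_mul_le_one

theorem bddAbove_fidelityValues [FiniteDimensional ℂ H]
    (ψ : Fin N → OrthonormalBasis (Fin d) ℂ H) : BddAbove (fidelityValues ψ) :=
  ⟨1, by rintro _ ⟨n, M, σ, rfl⟩; exact averageFidelity_le_one ψ M σ⟩

end Fidelity

end

end Incompatibility

namespace Incompatibility

open scoped ComplexConjugate

section PhaseSums

/-! An upper bound on `Q` is a lower bound on the optimal fidelity, so good strategies suffice. All
of them measure a weighted rank-one resolution of the identity and prepare the vector found, which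
scores a weighted sum of `|⟨v, ψ i j⟩|⁴`.

Measuring one of the given bases reproduces its own states perfectly, and Cauchy-Schwarz bounds the
score on every other basis; this gives `le_optimalFidelity_of_card`.

For `2 / (d + 1)`, a basis `b` is paired with the vectors of equal modulus and independent phases in
`b`. With weights `1 / (d + 1)` and `d / (d + 1)` the two together form a projective 2-design: the
fourth powers in the basis score cancel against those in the fourth moment of the phase sum. -/

theorem sum_normSq_add_phase (T c : ℂ) :
    ∑ t : Fin 4, Complex.normSq (conj (Complex.I ^ (t : ℕ)) * c + T) =
      4 * (Complex.normSq c + Complex.normSq T) := by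
  simp [Fin.sum_univ_four, Complex.normSq_apply, pow_succ]
  ring

/-- Fourth roots of unity suffice because both `z` and `z ^ 2` average to zero over them; signs
alone would fail on `z ^ 2`. -/
theorem sum_normSq_sq_add_phase (T c : ℂ) :
    ∑ t : Fin 4, Complex.normSq (conj (Complex.I ^ (t : ℕ)) * c + T) ^ 2 =
      4 * (Complex.normSq c ^ 2 + Complex.normSq T ^ 2 +
        4 * Complex.normSq c * Complex.normSq T) := by
  simp [Fin.sum_univ_four, Complex.normSq_apply, pow_succ]
  ring

theorem sum_fin_succ_arrow {n : ℕ} (f : (Fin (n + 1) → Fin 4) → ℝ) :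
    ∑ θ, f θ = ∑ θ : Fin n → Fin 4, ∑ t, f (Fin.cons t θ) := by
  rw [← (Fin.consEquiv fun _ : Fin (n + 1) => Fin 4).sum_comp, Fintype.sum_prod_type,
    Finset.sum_comm]
  rfl

/-- The second moment of a sum with independent uniform phases among the fourth roots of unity. -/
theorem sum_normSq_phase {n : ℕ} (c : Fin n → ℂ) :
    ∑ θ : Fin n → Fin 4, Complex.normSq (∑ k, conj (Complex.I ^ (θ k : ℕ)) * c k) =
      4 ^ n * ∑ k, Complex.normSq (c k) := by
  induction n with
  | zero => simp
  | succ n ih =>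
    rw [sum_fin_succ_arrow]
    simp only [Fin.sum_univ_succ (n := n), Fin.cons_zero, Fin.cons_succ, sum_normSq_add_phase]
    rw [← Finset.mul_sum, Finset.sum_add_distrib, ih]
    simp
    ring

/-- The fourth moment of a sum with independent uniform phases among the fourth roots of unity. -/
theorem sum_normSq_sq_phase {n : ℕ} (c : Fin n → ℂ) :
    ∑ θ : Fin n → Fin 4, Complex.normSq (∑ k, conj (Complex.I ^ (θ k : ℕ)) * c k) ^ 2 =
      4 ^ n * (2 * (∑ k, Complex.normSq (c k)) ^ 2 - ∑ k, Complex.normSq (c k) ^ 2) := by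
  induction n with
  | zero => simp
  | succ n ih =>
    rw [sum_fin_succ_arrow]
    -- Averaging over the phase of coordinate `0` leaves only the second and fourth moments of the
    -- remaining sum.
    have h : ∀ θ : Fin n → Fin 4,
        ∑ t : Fin 4, Complex.normSq (∑ k, conj (Complex.I ^
          ((Fin.cons t θ : Fin (n + 1) → Fin 4) k : ℕ)) * c k) ^ 2 =
        4 * (Complex.normSq (c 0) ^ 2 +
          Complex.normSq (∑ k, conj (Complex.I ^ (θ k : ℕ)) * c k.succ) ^ 2 +
          4 * Complex.normSq (c 0) *
            Complex.normSq (∑ k, conj (Complex.I ^ (θ k : ℕ)) * c k.succ)) := by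
      intro θ
      rw [← sum_normSq_sq_add_phase]
      simp only [Fin.sum_univ_succ (n := n), Fin.cons_zero, Fin.cons_succ]
    simp only [h]
    rw [← Finset.mul_sum, Finset.sum_add_distrib, Finset.sum_add_distrib, ← Finset.mul_sum,
      ih, sum_normSq_phase]
    simp [Fin.sum_univ_succ]
    ring

end PhaseSums

variable {H : Type*} [NormedAddCommGroup H] [InnerProductSpace ℂ H] {N d : ℕ}

theorem pureState_isPositive (v : H) : (pureState v).IsPositive :=
  (ContinuousLinearMap.isPositive_toLinearMap_iff _).2
    (InnerProductSpace.isPositive_rankOne_self v)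

theorem re_inner_pureState (v x : H) :
    (inner ℂ x (pureState v x)).re = Complex.normSq (inner ℂ v x) := by
  have h : inner ℂ x (pureState v x) = (Complex.normSq (inner ℂ v x) : ℂ) := by
    rw [Complex.normSq_eq_conj_mul_self, inner_conj_symm]
    simp [pureState, mul_comm]
  rw [h, Complex.ofReal_re]

/-- The projector on a unit vector as a state. -/
noncomputable def pureDensityOperator [FiniteDimensional ℂ H] (v : H) (hv : ‖v‖ = 1) :
    DensityOperator H where
  op := pureState v
  isPositive := pureState_isPositive v
  trace_eq_one := by
    have h := InnerProductSpace.trace_rankOne (𝕜 := ℂ) v v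
    rw [inner_self_eq_norm_sq_to_K, hv] at h
    simpa [pureState] using h

/-- The measurement whose effects are weighted rank-one projectors resolving the identity. -/
noncomputable def rankOnePOVM {n : ℕ} (v : Fin n → H) (w : Fin n → ℝ)
    (hw : ∀ a, 0 ≤ w a) (h : ∀ x, ∑ a, w a * Complex.normSq (inner ℂ (v a) x) = ‖x‖ ^ 2) :
    POVM H n where
  effect a := (w a : ℂ) • pureState (v a)
  isPositive a := (pureState_isPositive (v a)).smul_of_nonneg (by simpa using hw a)
  sum_eq_id := by
    rw [← ext_inner_map]
    intro x
    rw [LinearMap.sum_apply, sum_inner, LinearMap.id_apply, inner_self_eq_norm_sq_to_K]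
    have := congrArg (fun r : ℝ => (r : ℂ)) (h x)
    push_cast at this
    refine Eq.trans (Finset.sum_congr rfl fun a _ => ?_) this
    rw [LinearMap.smul_apply, inner_smul_left, Complex.conj_ofReal,
      Complex.normSq_eq_conj_mul_self, inner_conj_symm]
    simp [pureState, inner_smul_left]

/-- Measuring a weighted rank-one resolution of the identity and preparing the corresponding pure
states bounds the optimal fidelity from below. -/
theorem le_optimalFidelity_of_resolution [FiniteDimensional ℂ H]
    (ψ : Fin N → OrthonormalBasis (Fin d) ℂ H) {ι : Type*} [Fintype ι] (v : ι → H) (w : ι → ℝ)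
    (hv : ∀ a, ‖v a‖ = 1) (hw : ∀ a, 0 ≤ w a)
    (h : ∀ x, ∑ a, w a * Complex.normSq (inner ℂ (v a) x) = ‖x‖ ^ 2) :
    1 / ((N : ℝ) * d) * ∑ i, ∑ j, ∑ a, w a * Complex.normSq (inner ℂ (v a) (ψ i j)) ^ 2 ≤
      optimalFidelity ψ := by
  let e := (Fintype.equivFin ι).symm
  refine le_csSup (bddAbove_fidelityValues ψ) ⟨Fintype.card ι,
    rankOnePOVM (v ∘ e) (w ∘ e) (fun a => hw _)
      (fun x => (e.sum_comp fun a => w a * Complex.normSq (inner ℂ (v a) x)).trans (h x)),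
    fun a => pureDensityOperator (v (e a)) (hv _), ?_⟩
  unfold averageFidelity
  congr 1
  refine Finset.sum_congr rfl fun i _ => Finset.sum_congr rfl fun j _ => ?_
  rw [← e.sum_comp]
  refine Finset.sum_congr rfl fun a _ => ?_
  rw [trace_pureState_mul, trace_pureState_mul]
  simp only [rankOnePOVM, pureDensityOperator, LinearMap.smul_apply, inner_smul_right,
    Complex.re_ofReal_mul, re_inner_pureState, Function.comp_apply]
  ring

theorem sum_normSq_inner (b : OrthonormalBasis (Fin d) ℂ H) (x : H) :
    ∑ k, Complex.normSq (inner ℂ (b k) x) = ‖x‖ ^ 2 := by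
  simp only [Complex.normSq_eq_norm_sq]
  exact b.sum_sq_norm_inner_right x

/-- The unit vector with coordinates of equal modulus and phases `I ^ θ k` in the basis `b`. -/
noncomputable def phaseVector (b : OrthonormalBasis (Fin d) ℂ H) (θ : Fin d → Fin 4) : H :=
  ((√(d : ℝ))⁻¹ : ℂ) • ∑ k, Complex.I ^ (θ k : ℕ) • b k

theorem normSq_inner_phaseVector (b : OrthonormalBasis (Fin d) ℂ H) (θ : Fin d → Fin 4) (x : H) :
    Complex.normSq (inner ℂ (phaseVector b θ) x) =
      (d : ℝ)⁻¹ * Complex.normSq (∑ k, conj (Complex.I ^ (θ k : ℕ)) * inner ℂ (b k) x) := by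
  rw [phaseVector, inner_smul_left, sum_inner, Complex.normSq_mul]
  simp only [inner_smul_left]
  congr 1
  rw [← Complex.ofReal_inv, Complex.conj_ofReal, Complex.normSq_ofReal, ← mul_inv,
    Real.mul_self_sqrt d.cast_nonneg]

theorem norm_phaseVector (hd : 1 ≤ d) (b : OrthonormalBasis (Fin d) ℂ H) (θ : Fin d → Fin 4) :
    ‖phaseVector b θ‖ = 1 := by
  have hd0 : (d : ℝ) ≠ 0 := by positivity
  have hk : ∀ k, Complex.normSq (inner ℂ (b k) (phaseVector b θ)) = (d : ℝ)⁻¹ := by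
    intro k
    rw [phaseVector, inner_smul_right, b.orthonormal.inner_right_fintype, Complex.normSq_mul,
      map_pow, Complex.normSq_I, one_pow, mul_one, ← Complex.ofReal_inv, Complex.normSq_ofReal,
      ← mul_inv, Real.mul_self_sqrt d.cast_nonneg]
  have h := sum_normSq_inner b (phaseVector b θ)
  simp only [hk, Finset.sum_const, Finset.card_univ, Fintype.card_fin, nsmul_eq_mul] at h
  rw [mul_inv_cancel₀ hd0] at h
  exact (pow_eq_one_iff_of_nonneg (norm_nonneg _) two_ne_zero).1 h.symm

theorem le_optimalFidelity_of_basis [FiniteDimensional ℂ H]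
    (ψ : Fin N → OrthonormalBasis (Fin d) ℂ H) (b : OrthonormalBasis (Fin d) ℂ H) :
    1 / ((N : ℝ) * d) * ∑ i, ∑ j, ∑ k, Complex.normSq (inner ℂ (b k) (ψ i j)) ^ 2 ≤
      optimalFidelity ψ := by
  simpa using le_optimalFidelity_of_resolution ψ b (fun _ => 1) b.norm_eq_one
    (fun _ => zero_le_one) (fun x => by simpa using sum_normSq_inner b x)

theorem le_optimalFidelity_of_phaseVector [FiniteDimensional ℂ H] (hd : 1 ≤ d)
    (ψ : Fin N → OrthonormalBasis (Fin d) ℂ H) (b : OrthonormalBasis (Fin d) ℂ H) :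
    1 / ((N : ℝ) * d) * ∑ i, ∑ j,
      (d : ℝ)⁻¹ * (2 - ∑ k, Complex.normSq (inner ℂ (b k) (ψ i j)) ^ 2) ≤ optimalFidelity ψ := by
  have hd0 : (d : ℝ) ≠ 0 := by positivity
  -- There are `4 ^ d` phase vectors of norm one, so equal weights of total `d`, the trace of the
  -- identity, are forced.
  convert le_optimalFidelity_of_resolution ψ (phaseVector b) (fun _ => (d : ℝ) / 4 ^ d)
    (norm_phaseVector hd b) (fun _ => by positivity) (fun x => ?_) using 5 with i _ j _
  · simp only [normSq_inner_phaseVector, mul_pow]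
    rw [← Finset.mul_sum, ← Finset.mul_sum, sum_normSq_sq_phase, sum_normSq_inner,
      (ψ i).norm_eq_one]
    field_simp
  · simp only [normSq_inner_phaseVector]
    rw [← Finset.mul_sum, ← Finset.mul_sum, sum_normSq_phase, sum_normSq_inner]
    field_simp

/-- For each `j` the squared overlaps are `d` probabilities, so by Cauchy-Schwarz their squares sum
to at least `1 / d`. -/
theorem one_le_sum_normSq_inner_sq (hd : 1 ≤ d) (b c : OrthonormalBasis (Fin d) ℂ H) :
    1 ≤ ∑ j, ∑ k, Complex.normSq (inner ℂ (b k) (c j)) ^ 2 := by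
  have hd0 : (0 : ℝ) < d := by positivity
  have hj : ∀ j, (d : ℝ)⁻¹ ≤ ∑ k, Complex.normSq (inner ℂ (b k) (c j)) ^ 2 := by
    intro j
    have h := sq_sum_le_card_mul_sum_sq (s := Finset.univ)
      (f := fun k => Complex.normSq (inner ℂ (b k) (c j)))
    rw [sum_normSq_inner, c.norm_eq_one] at h
    rw [inv_le_iff_one_le_mul₀' hd0]
    simpa using h
  calc (1 : ℝ) = ∑ _j : Fin d, (d : ℝ)⁻¹ := by simp [hd0.ne']
    _ ≤ _ := Finset.sum_le_sum fun j _ => hj j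

theorem sum_normSq_inner_self_sq (b : OrthonormalBasis (Fin d) ℂ H) :
    ∑ j, ∑ k, Complex.normSq (inner ℂ (b k) (b j)) ^ 2 = d := by
  simp [b.inner_eq_ite, apply_ite]

theorem le_optimalFidelity_of_card [FiniteDimensional ℂ H] (hN : 1 ≤ N) (hd : 1 ≤ d)
    (ψ : Fin N → OrthonormalBasis (Fin d) ℂ H) :
    ((d : ℝ) + (N - 1)) / (N * d) ≤ optimalFidelity ψ := by
  let m : Fin N := ⟨0, hN⟩
  refine le_trans ?_ (le_optimalFidelity_of_basis ψ (ψ m))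
  rw [div_eq_inv_mul, one_div]
  refine mul_le_mul_of_nonneg_left ?_ (by positivity)
  rw [← Finset.add_sum_erase _ _ (Finset.mem_univ m), sum_normSq_inner_self_sq]
  refine add_le_add_right ?_ _
  have h := Finset.card_nsmul_le_sum (Finset.univ.erase m) _ (1 : ℝ)
    fun i _ => one_le_sum_normSq_inner_sq hd (ψ m) (ψ i)
  simpa [Finset.card_erase_of_mem, Nat.cast_sub hN] using h

theorem two_div_le_optimalFidelity [FiniteDimensional ℂ H] (hN : 1 ≤ N) (hd : 1 ≤ d)
    (ψ : Fin N → OrthonormalBasis (Fin d) ℂ H) :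
    2 / ((d : ℝ) + 1) ≤ optimalFidelity ψ := by
  have hd0 : (0 : ℝ) < d := by positivity
  have hN0 : (0 : ℝ) < N := by positivity
  -- Any orthonormal basis would serve here.
  let b := ψ ⟨0, hN⟩
  have h1 := le_optimalFidelity_of_basis ψ b
  have h2 := le_optimalFidelity_of_phaseVector hd ψ b
  simp only [← Finset.mul_sum, Finset.sum_sub_distrib, Finset.sum_const, Finset.card_univ,
    Fintype.card_fin, nsmul_eq_mul] at h2
  generalize ∑ i, ∑ j, ∑ k, Complex.normSq (inner ℂ (b k) (ψ i j)) ^ 2 = S at h1 h2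
  -- The basis score plus `d` times the phase score is exactly `2`, whatever `S` is.
  have h3 := mul_le_mul_of_nonneg_left h2 hd0.le
  have h4 : (d : ℝ) * (1 / ((N : ℝ) * d) * ((d : ℝ)⁻¹ * (N * (d * 2) - S))) =
      2 - 1 / ((N : ℝ) * d) * S := by
    field_simp
  rw [div_le_iff₀ (by positivity)]
  linarith

end Incompatibility

/-- Upper bounds on the incompatibility of `N` observables `A i` on a `d`-dimensional space, with
orthonormal eigenbases `ψ i`. Both bounds hold for every `N`; the first one is the smaller one for
`N ≤ d + 1`, the second one for `N ≥ d + 1`. The observables may be noncommuting in any sense: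
no hypothesis on their commutators is made. -/
theorem theorem1 {H : Type*} [NormedAddCommGroup H] [InnerProductSpace ℂ H]
    [FiniteDimensional ℂ H] (N d : ℕ) (hN : 1 ≤ N) (hd : 1 ≤ d)
    (hdim : Module.finrank ℂ H = d)
    (A : Fin N → (H →ₗ[ℂ] H)) (hA : ∀ i, (A i).IsSymmetric)
    (ψ : Fin N → OrthonormalBasis (Fin d) ℂ H)
    (hψ : ∀ i, Incompatibility.IsEigenbasis (A i) (ψ i)) :
    Incompatibility.incompatibility ψ ≤ (1 - 1 / (N : ℝ)) * (1 - 1 / (d : ℝ)) ∧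
    Incompatibility.incompatibility ψ ≤ ((d : ℝ) - 1) / ((d : ℝ) + 1) ∧
    (N ≤ d + 1 →
      (1 - 1 / (N : ℝ)) * (1 - 1 / (d : ℝ)) ≤ ((d : ℝ) - 1) / ((d : ℝ) + 1)) ∧
    (d + 1 ≤ N →
      ((d : ℝ) - 1) / ((d : ℝ) + 1) ≤ (1 - 1 / (N : ℝ)) * (1 - 1 / (d : ℝ))) := by
  have hd0 : (0 : ℝ) < d := by positivity
  have hN0 : (0 : ℝ) < N := by positivity
  have hd1 : (0 : ℝ) ≤ (d : ℝ) - 1 := by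
    have : (1 : ℝ) ≤ d := by exact_mod_cast hd
    linarith
  -- In this form the factor `d + 1 - N` decides both comparisons.
  have hdiff : ((d : ℝ) - 1) / ((d : ℝ) + 1) - (1 - 1 / (N : ℝ)) * (1 - 1 / (d : ℝ)) =
      ((d : ℝ) - 1) * ((d : ℝ) + 1 - N) / (((d : ℝ) + 1) * N * d) := by
    field_simp
    ring
  refine ⟨?_, ?_, fun h => ?_, fun h => ?_⟩
  · have h := Incompatibility.le_optimalFidelity_of_card hN hd ψ
    have e : (1 - 1 / (N : ℝ)) * (1 - 1 / (d : ℝ)) = 1 - ((d : ℝ) + (N - 1)) / (N * d) := by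
      field_simp
      ring
    rw [e, Incompatibility.incompatibility]
    linarith
  · have h := Incompatibility.two_div_le_optimalFidelity hN hd ψ
    have e : ((d : ℝ) - 1) / ((d : ℝ) + 1) = 1 - 2 / ((d : ℝ) + 1) := by
      field_simp
      ring
    rw [e, Incompatibility.incompatibility]
    linarith
  · have h' : (N : ℝ) ≤ d + 1 := by exact_mod_cast h
    rw [← sub_nonneg, hdiff]
    exact div_nonneg (mul_nonneg hd1 (by linarith)) (by positivity)
  · have h' : (d : ℝ) + 1 ≤ N := by exact_mod_cast h
    rw [← sub_nonpos, hdiff]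
    exact div_nonpos_of_nonpos_of_nonneg (mul_nonpos_of_nonneg_of_nonpos hd1 (by linarith))
      (by positivity)
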